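/- Let $n\ge 1$ be an integer, $p,q\in[1,\infty)$ and $\lambda,\sigma,\alpha,\beta\in(0,\infty)$. For $T\in\mathbb R$ put $\mathbb R_T=(-\infty,T)$. Let $X^p$ be the set of measurable $f:\mathbb R^n\times\mathbb R\to\mathbb R$ with $\|f\|_{L^p(\mathbb R^n\times\mathbb R_T)}<\infty$ for all $T\in\mathbb R$. Let $$\Phi_\alpha(x,t)=\frac{t^{\alpha-1}}{\Gamma(\alpha)}\,\frac{1}{(4\pi t)^{n/2}}\,e^{-|x|^2/(4t)}\ \text{ for } t>0,\qquad \Phi_\alpha(x,t)=0\ \text{ for } t\le 0,$$ $$J_\alpha f(x,t)=\iint_{\mathbb R^n\times\mathbb R_t}\Phi_\alpha(x-\xi,t-\tau)f(\xi,\tau)\,d\xi\,d\tau,\qquad Y^p_\alpha=J_\alpha(X^p),$$ where functions that agree almost everywhere are identified. Assume $$\Bigl(p>1\text{ and }0<\alpha<\tfrac{n+2}{2p}\Bigr)\text{ or }\Bigl(p=1\text{ and }0<\alpha\le\tfrac{n+2}{2p}\Bigr),$$ and likewise $$\Bigl(q>1\text{ and }0<\beta<\tfrac{n+2}{2q}\Bigr)\text{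 or }\Bigl(q=1\text{ and }0<\beta\le\tfrac{n+2}{2q}\Bigr).$$ Under these conditions $J_\alpha:X^p\to Y^p_\alpha$ and $J_\beta:X^q\to Y^q_\beta$ are bijective, and $(\partial_t-\Delta)^\alpha:Y^p_\alpha\to X^p$ and $(\partial_t-\Delta)^\beta:Y^q_\beta\to X^q$ denote their inverses. **Theorem 2.1.** Suppose in addition that $2p\alpha<n+2$, that $$(n+2-2p\alpha)\,q^2\sigma\le(n+2-2q\beta)\,p^2\lambda,$$ and that $$\frac1\lambda\le\sigma<\mu(\lambda):=\frac{2p\beta}{n+2-2p\alpha}+\frac{n+2}{(n+2-2p\alpha)\lambda}.$$ If $u\in Y^p_\alpha$ and $v\in Y^q_\beta$ satisfy $$0\le(\partial_t-\Delta)^\alpha u\le v^\lambda,\qquad 0\le(\partial_t-\Delta)^\beta v\le u^\sigma\qquad\text{a.e. in }\mathbb R^n\times\mathbb R,$$ and $u=v=0$ a.e. in $\mathbb R^n\times(-\infty,0)$, then $u=v=0$ a.e. in $\mathbb R^n\times\mathbb R$. -/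

import Mathlib

open MeasureTheory Set Filter

noncomputable section

namespace FracHeat

/-- Space-time `ℝⁿ × ℝ` (Euclidean norm on `ℝⁿ`, Lebesgue product measure); points are `(x, t)`. -/
abbrev SpaceTime (n : ℕ) : Type := EuclideanSpace ℝ (Fin n) × ℝ

/-- The fractional heat kernel
`Φ_α(x,t) = t^(α-1) / Γ(α) * (4πt)^(-n/2) * exp(-|x|²/(4t))` for `t > 0`, and `0` for `t ≤ 0`. -/
def heatKernel (n : ℕ) (α : ℝ) (x : EuclideanSpace ℝ (Fin n)) (t : ℝ) : ℝ :=
  if 0 < t then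
    t ^ (α - 1) / Real.Gamma α * (1 / (4 * Real.pi * t) ^ ((n : ℝ) / 2)) *
      Real.exp (-(‖x‖ ^ 2) / (4 * t))
  else 0

/-- `X^p`: the functions that belong to `L^p(ℝⁿ × (-∞,T))` for every real `T`. -/
def X (n : ℕ) (p : ℝ) : Set (SpaceTime n → ℝ) :=
  {f | ∀ T : ℝ, MemLp f (ENNReal.ofReal p) (volume.restrict (univ ×ˢ Iio T))}

/-- `J_α f(x,t) = ∬_{ℝⁿ × (-∞,t)} Φ_α(x-ξ, t-τ) f(ξ,τ) dξ dτ`. -/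
def J (n : ℕ) (α : ℝ) (f : SpaceTime n → ℝ) (z : SpaceTime n) : ℝ :=
  ∫ w in (univ ×ˢ Iio z.2 : Set (SpaceTime n)), heatKernel n α (z.1 - w.1) (z.2 - w.2) * f w

/-- `Y^p_α = J_α(X^p)`, functions being identified when they agree almost everywhere. -/
def Y (n : ℕ) (p α : ℝ) : Set (SpaceTime n → ℝ) :=
  {u | ∃ f ∈ X n p, J n α f =ᵐ[volume] u}

/-- The range of exponents in which `J_α : X^p → Y^p_α` is well defined and invertible. -/
def Admissible (n : ℕ) (p α : ℝ) : Prop :=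
  (1 < p ∧ 0 < α ∧ α < ((n : ℝ) + 2) / (2 * p)) ∨
  (p = 1 ∧ 0 < α ∧ α ≤ ((n : ℝ) + 2) / (2 * p))

open Classical in
/-- The fully fractional heat operator `(∂_t - Δ)^α : Y^p_α → X^p`, the inverse of
`J_α : X^p → Y^p_α`: for `u ∈ Y^p_α` it is a representative of the a.e.-class of those `f ∈ X^p`
with `J_α f = u` a.e. (outside `Y^p_α`, where the operator is undefined, the value is `0`). -/
def fracHeat (n : ℕ) (p α : ℝ) (u : SpaceTime n → ℝ) : SpaceTime n → ℝ :=
  if h : ∃ f ∈ X n p, J n α f =ᵐ[volume] u then h.choose else 0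

theorem fracHeat_mem {n : ℕ} {p α : ℝ} {u : SpaceTime n → ℝ} (hu : u ∈ Y n p α) :
    fracHeat n p α u ∈ X n p := by
  have h : ∃ f ∈ X n p, J n α f =ᵐ[volume] u := hu
  rw [fracHeat, dif_pos h]
  exact h.choose_spec.1

theorem J_fracHeat {n : ℕ} {p α : ℝ} {u : SpaceTime n → ℝ} (hu : u ∈ Y n p α) :
    J n α (fracHeat n p α u) =ᵐ[volume] u := by
  have h : ∃ f ∈ X n p, J n α f =ᵐ[volume] u := hu
  rw [fracHeat, dif_pos h]
  exact h.choose_spec.2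

/-- The curve `μ(λ) = 2pβ / (n+2-2pα) + (n+2) / ((n+2-2pα) λ)`. -/
def mu (n : ℕ) (p α β lam : ℝ) : ℝ :=
  2 * p * β / ((n : ℝ) + 2 - 2 * p * α) + ((n : ℝ) + 2) / (((n : ℝ) + 2 - 2 * p * α) * lam)

end FracHeat

end

/-!
The inequalities are integral inequalities: with `f = (∂_t - Δ)^α u` and `g = (∂_t - Δ)^β v` they
say that `0 ≤ f ≤ (J_β g) ^ λ` and `0 ≤ g ≤ (J_α f) ^ σ`. On a slab of time length `δ` on which `f`
and `g` vanish at earlier times only the kernel cut off at time `δ` matters. It belongs to `L^m` for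
`1 / m > 1 - 2 α / (n + 2)`, with a norm that tends to `0` as `δ → 0`, so that Young's inequality
bounds `J_α : L^p → L^r` for `1 / p - 2 α / (n + 2) < 1 / r ≤ 1 / p` by a small constant
(`exists_heatPot_bound`).

Applied to both potentials, this gives `I ≤ ε(δ) * I ^ (λ σ)` for the integral `I` of `f ^ P` over
the slab, where `ε(δ) → 0`. Since `λ σ ≥ 1` and `I` stays below its value on a longer slab, `I = 0`
for small `δ`, uniformly in the position of the slab, and `f` vanishes by stepping forward in time
(`eq_zero_before`).

The intermediate exponent `r` has to satisfy several inequalities (`exists_exponent`). The decisive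
one, that the loop from `L^P` back to `L^P` loses no integrability, is `σ < μ(λ)`. In addition,
Young's inequality for `g ≤ (J_α f) ^ σ` needs an exponent `r / σ ≥ 1`, which is possible because of
the normalization of the two exponent pairs (`sig_mul_lt_one`), and for `J_β g` an exponent
`λ P ≥ 1`. The latter holds for `P = p` or, after an improvement of the integrability of `f`, for
`P = 1 / λ` (`eq_zero_of_integral_inequalities`).

All estimates are made for lower integrals of `[0, ∞]`-valued functions, so that the finiteness of
the potentials plays no role.
-/

open scoped ENNReal Topology


/-! ### Young's inequality -/

/-- Young's convolution inequality for `[0, ∞]`-valued functions with finite exponents, in the form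
obtained by raising both sides to the power `r`. No finiteness of the integrals is needed. -/
theorem lintegral_conv_rpow_le {G : Type*} [AddCommGroup G] [MeasurableSpace G]
    [MeasurableAdd₂ G] [MeasurableNeg G] {μ : Measure G} [SFinite μ] [μ.IsAddLeftInvariant]
    [μ.IsNegInvariant] {k f : G → ℝ≥0∞} (hk : Measurable k) (hf : Measurable f) {m p r : ℝ}
    (hm : 1 ≤ m) (hp : 1 ≤ p) (hr : 1 ≤ r) (h : 1 + 1 / r = 1 / m + 1 / p) :
    ∫⁻ z, (∫⁻ w, k (z - w) * f w ∂μ) ^ r ∂μ ≤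
      (∫⁻ z, k z ^ m ∂μ) ^ (r / m) * (∫⁻ z, f z ^ p ∂μ) ^ (r / p) := by
  have m0 : 0 < m := by linarith
  have p0 : 0 < p := by linarith
  have r0 : 0 < r := by linarith
  have hm1 : 1 / m ≤ 1 := by rw [div_le_one m0]; exact hm
  have hp1 : 1 / p ≤ 1 := by rw [div_le_one p0]; exact hp
  have em : 0 ≤ 1 / m - 1 / r := by linarith
  have ep : 0 ≤ 1 / p - 1 / r := by linarith
  have er : 0 ≤ 1 / r := by positivity
  have key : ∀ z, (∫⁻ w, k (z - w) * f w ∂μ) ^ r ≤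
      (∫⁻ w, k (z - w) ^ m * f w ^ p ∂μ) *
        ((∫⁻ w, k w ^ m ∂μ) ^ (r / m - 1) * (∫⁻ w, f w ^ p ∂μ) ^ (r / p - 1)) := by
    intro z
    have hkz : Measurable fun w => k (z - w) := hk.comp (measurable_const.sub measurable_id)
    -- Hölder with three factors, whose exponents add up to `1`.
    have H := ENNReal.lintegral_prod_norm_pow_le (μ := μ) (Finset.univ : Finset (Fin 3))
      (f := ![fun w => k (z - w) ^ m * f w ^ p, fun w => k (z - w) ^ m, fun w => f w ^ p])
      (p := ![1 / r, 1 / m - 1 / r, 1 / p - 1 / r])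
      (by
        intro i _
        fin_cases i
        · exact ((hkz.pow_const m).mul (hf.pow_const p)).aemeasurable
        · exact (hkz.pow_const m).aemeasurable
        · exact (hf.pow_const p).aemeasurable)
      (by simp only [Fin.sum_univ_three]; simp; simp at h; linarith)
      (by
        intro i _
        fin_cases i
        · exact er
        · exact em
        · exact ep)
    simp only [Fin.prod_univ_three, Matrix.cons_val_zero, Matrix.cons_val_one,
      Matrix.cons_val] at H
    have hpt : ∀ w, k (z - w) * f w = (k (z - w) ^ m * f w ^ p) ^ (1 / r) *
        (k (z - w) ^ m) ^ (1 / m - 1 / r) * (f w ^ p) ^ (1 / p - 1 / r) := by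
      intro w
      have split : ∀ (x : ℝ≥0∞) {s : ℝ}, 0 < s → 0 ≤ 1 / s - 1 / r →
          (x ^ s) ^ (1 / r) * (x ^ s) ^ (1 / s - 1 / r) = x := by
        intro x s hs hs'
        rw [← ENNReal.rpow_add_of_nonneg _ _ er hs', ← ENNReal.rpow_mul]
        have : s * (1 / r + (1 / s - 1 / r)) = 1 := by field_simp; ring
        rw [this, ENNReal.rpow_one]
      rw [ENNReal.mul_rpow_of_nonneg _ _ er]
      conv_lhs => rw [← split (k (z - w)) m0 em, ← split (f w) p0 ep]
      ring
    have hinv : ∫⁻ w, k (z - w) ^ m ∂μ = ∫⁻ w, k w ^ m ∂μ :=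
      lintegral_sub_left_eq_self (fun w => k w ^ m) z
    simp_rw [← hpt, hinv] at H
    calc (∫⁻ w, k (z - w) * f w ∂μ) ^ r ≤ _ := ENNReal.rpow_le_rpow H r0.le
      _ = _ := by
        rw [ENNReal.mul_rpow_of_nonneg _ _ r0.le, ENNReal.mul_rpow_of_nonneg _ _ r0.le,
          ← ENNReal.rpow_mul, ← ENNReal.rpow_mul, ← ENNReal.rpow_mul, mul_assoc]
        have e1 : 1 / r * r = 1 := by field_simp
        have e2 : (1 / m - 1 / r) * r = r / m - 1 := by field_simp
        have e3 : (1 / p - 1 / r) * r = r / p - 1 := by field_simp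
        rw [e1, e2, e3, ENNReal.rpow_one]
  have emr : 0 ≤ r / m - 1 := by
    have : r / m - 1 = (1 / m - 1 / r) * r := by field_simp
    rw [this]; positivity
  have epr : 0 ≤ r / p - 1 := by
    have : r / p - 1 = (1 / p - 1 / r) * r := by field_simp
    rw [this]; positivity
  have hm2 : Measurable fun x : G × G => k (x.1 - x.2) ^ m * f x.2 ^ p :=
    ((hk.comp (measurable_fst.sub measurable_snd)).pow_const m).mul
      ((hf.comp measurable_snd).pow_const p)
  calc ∫⁻ z, (∫⁻ w, k (z - w) * f w ∂μ) ^ r ∂μ ≤ _ := lintegral_mono key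
    _ = (∫⁻ z, ∫⁻ w, k (z - w) ^ m * f w ^ p ∂μ ∂μ) *
        ((∫⁻ w, k w ^ m ∂μ) ^ (r / m - 1) * (∫⁻ w, f w ^ p ∂μ) ^ (r / p - 1)) :=
      lintegral_mul_const _ hm2.lintegral_prod_right'
    _ = ((∫⁻ z, k z ^ m ∂μ) * ∫⁻ w, f w ^ p ∂μ) *
        ((∫⁻ w, k w ^ m ∂μ) ^ (r / m - 1) * (∫⁻ w, f w ^ p ∂μ) ^ (r / p - 1)) := by
      congr 1
      rw [lintegral_lintegral_swap hm2.aemeasurable]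
      have : ∀ w, ∫⁻ z, k (z - w) ^ m * f w ^ p ∂μ = (∫⁻ z, k z ^ m ∂μ) * f w ^ p := by
        intro w
        have hkw : Measurable fun z => k (z - w) := hk.comp (measurable_id.sub_const w)
        rw [lintegral_mul_const _ (hkw.pow_const m)]
        congr 1
        exact lintegral_sub_right_eq_self (fun z => k z ^ m) w
      simp_rw [this]
      exact lintegral_const_mul _ (hf.pow_const p)
    _ = _ := by
      have e1 : r / m = 1 + (r / m - 1) := by ring
      have e2 : r / p = 1 + (r / p - 1) := by ring
      conv_rhs => rw [e1, e2, ENNReal.rpow_add_of_nonneg _ _ zero_le_one emr,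
        ENNReal.rpow_add_of_nonneg _ _ zero_le_one epr, ENNReal.rpow_one, ENNReal.rpow_one]
      ring

namespace FracHeat

/-! ### Integrability of the truncated kernel -/

/-- The kernel `Φ_α` cut off at time `δ`, with values in `[0, ∞]`. -/
noncomputable def truncKernel (n : ℕ) (α δ : ℝ) (z : SpaceTime n) : ℝ≥0∞ :=
  if z.2 < δ then ENNReal.ofReal (heatKernel n α z.1 z.2) else 0

theorem measurable_heatKernel (n : ℕ) (α : ℝ) :
    Measurable fun z : SpaceTime n => heatKernel n α z.1 z.2 := by
  unfold heatKernel
  refine Measurable.ite (measurableSet_lt measurable_const measurable_snd) ?_ measurable_const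
  fun_prop

theorem heatKernel_nonneg (n : ℕ) {α : ℝ} (hα : 0 < α) (x : EuclideanSpace ℝ (Fin n)) (t : ℝ) :
    0 ≤ heatKernel n α x t := by
  unfold heatKernel
  split_ifs with h
  · have := Real.Gamma_pos_of_pos hα
    positivity
  · exact le_rfl

theorem measurable_truncKernel (n : ℕ) (α δ : ℝ) : Measurable (truncKernel n α δ) :=
  Measurable.ite (measurableSet_lt measurable_snd measurable_const)
    (measurable_heatKernel n α).ennreal_ofReal measurable_const

/-- The constant in the space integral of the `m`-th power of `Φ_α`. -/
noncomputable def gaussConst (n : ℕ) (α m : ℝ) : ℝ :=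
  ((Real.Gamma α)⁻¹ * (4 * Real.pi) ^ (-((n : ℝ) / 2))) ^ m * (4 * Real.pi / m) ^ ((n : ℝ) / 2)

/-- The space integral of `Φ_α(·, t) ^ m` is a power of `t`. -/
theorem lintegral_heatKernel_rpow {n : ℕ} {α m t : ℝ} (hα : 0 < α) (hm : 1 ≤ m) (ht : 0 < t) :
    ∫⁻ x : EuclideanSpace ℝ (Fin n), ENNReal.ofReal (heatKernel n α x t) ^ m =
      ENNReal.ofReal (gaussConst n α m * t ^ (m * (α - 1 - (n : ℝ) / 2) + (n : ℝ) / 2)) := by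
  have m0 : 0 < m := by linarith
  have hΓ := Real.Gamma_pos_of_pos hα
  have hpi := Real.pi_pos
  have hb : 0 < m / (4 * t) := by positivity
  have hpt : ∀ x : EuclideanSpace ℝ (Fin n), ENNReal.ofReal (heatKernel n α x t) ^ m =
      ENNReal.ofReal (((Real.Gamma α)⁻¹ * (4 * Real.pi) ^ (-((n : ℝ) / 2))) ^ m *
        t ^ (m * (α - 1 - (n : ℝ) / 2))) *
        ENNReal.ofReal (Real.exp (-(m / (4 * t)) * ‖x‖ ^ 2)) := by
    intro x
    rw [ENNReal.ofReal_rpow_of_nonneg (heatKernel_nonneg n hα x t) m0.le,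
      ← ENNReal.ofReal_mul (by positivity)]
    congr 1
    rw [heatKernel, if_pos ht]
    have e1 : t ^ (α - 1) / Real.Gamma α * (1 / (4 * Real.pi * t) ^ ((n : ℝ) / 2)) =
        ((Real.Gamma α)⁻¹ * (4 * Real.pi) ^ (-((n : ℝ) / 2))) * t ^ (α - 1 - (n : ℝ) / 2) := by
      rw [Real.mul_rpow (by positivity) ht.le, Real.rpow_neg (by positivity),
        Real.rpow_sub ht (α - 1)]
      field_simp
    rw [e1, Real.mul_rpow (by positivity) (by positivity),
      Real.mul_rpow (by positivity) (by positivity), ← Real.rpow_mul ht.le, ← Real.exp_mul,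
      mul_comm m (α - 1 - (n : ℝ) / 2)]
    congr 2
    field_simp
  simp_rw [hpt]
  have hI := GaussianFourier.integral_rexp_neg_mul_sq_norm (V := EuclideanSpace ℝ (Fin n)) hb
  -- The integral has a nonzero value, hence the Gaussian is integrable.
  have hint : Integrable fun x : EuclideanSpace ℝ (Fin n) =>
      Real.exp (-(m / (4 * t)) * ‖x‖ ^ 2) := by
    by_contra hcon
    rw [integral_undef hcon] at hI
    have : 0 < (Real.pi / (m / (4 * t))) ^
      ((Module.finrank ℝ (EuclideanSpace ℝ (Fin n)) : ℝ) / 2) := by positivity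
    linarith
  rw [lintegral_const_mul' _ _ ENNReal.ofReal_ne_top,
    ← ofReal_integral_eq_lintegral_ofReal hint (ae_of_all _ fun x => (Real.exp_pos _).le), hI,
    ← ENNReal.ofReal_mul (by positivity)]
  congr 1
  have e2 : Real.pi / (m / (4 * t)) = 4 * Real.pi / m * t := by field_simp
  rw [e2, finrank_euclideanSpace_fin, Real.mul_rpow (by positivity) ht.le, Real.rpow_add ht,
    gaussConst]
  ring

theorem lintegral_truncKernel_rpow {n : ℕ} {α m : ℝ} (δ : ℝ) (hα : 0 < α) (hm : 1 ≤ m) :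
    ∫⁻ z : SpaceTime n, truncKernel n α δ z ^ m =
      ∫⁻ t in Ioo 0 δ, ENNReal.ofReal
        (gaussConst n α m * t ^ (m * (α - 1 - (n : ℝ) / 2) + (n : ℝ) / 2)) := by
  have m0 : 0 < m := by linarith
  rw [Measure.volume_eq_prod,
    lintegral_prod_symm _ ((measurable_truncKernel n α δ).pow_const m).aemeasurable,
    ← lintegral_indicator measurableSet_Ioo]
  refine lintegral_congr fun t => ?_
  by_cases ht : t ∈ Ioo 0 δ
  · rw [indicator_of_mem ht, ← lintegral_heatKernel_rpow hα hm ht.1]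
    simp only [truncKernel, if_pos ht.2]
  · rw [indicator_of_notMem ht]
    have : ∀ x : EuclideanSpace ℝ (Fin n), truncKernel n α δ (x, t) ^ m = 0 := by
      intro x
      have h0 : truncKernel n α δ (x, t) = 0 := by
        simp only [truncKernel]
        split_ifs with h
        · rw [heatKernel, if_neg fun h0 => ht ⟨h0, h⟩, ENNReal.ofReal_zero]
        · rfl
      rw [h0, ENNReal.zero_rpow_of_pos m0]
    simp [this]

/-- The truncated kernel belongs to `L^m` for `1 / m > 1 - 2 α / (n + 2)`. -/
theorem lintegral_truncKernel_rpow_ne_top {n : ℕ} {α m : ℝ} (δ : ℝ) (hα : 0 < α) (hm : 1 ≤ m)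
    (h : 1 - 2 * α / ((n : ℝ) + 2) < 1 / m) : ∫⁻ z : SpaceTime n, truncKernel n α δ z ^ m ≠ ⊤ := by
  have m0 : 0 < m := by linarith
  have ha : -1 < m * (α - 1 - (n : ℝ) / 2) + (n : ℝ) / 2 := by
    have hN : (0 : ℝ) < (n : ℝ) + 2 := by positivity
    rw [lt_div_iff₀ m0] at h
    have : (1 - 2 * α / ((n : ℝ) + 2)) * m * ((n : ℝ) + 2) < 1 * ((n : ℝ) + 2) := by gcongr
    field_simp at this
    nlinarith
  rw [lintegral_truncKernel_rpow δ hα hm]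
  rcases le_or_gt δ 0 with hδ | hδ
  · simp [Ioo_eq_empty_of_le hδ]
  · have := ((intervalIntegral.integrableOn_Ioo_rpow_iff hδ).2 ha).const_mul (gaussConst n α m)
    exact this.lintegral_lt_top.ne

/-- The `L^m` norm of the truncated kernel vanishes as the cut-off time tends to `0`. -/
theorem tendsto_lintegral_truncKernel_rpow {n : ℕ} {α m : ℝ} (hα : 0 < α) (hm : 1 ≤ m)
    (h : 1 - 2 * α / ((n : ℝ) + 2) < 1 / m) :
    Tendsto (fun δ => ∫⁻ z : SpaceTime n, truncKernel n α δ z ^ m) (𝓝[>] 0) (𝓝 0) := by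
  have hfin := lintegral_truncKernel_rpow_ne_top (n := n) 1 hα hm h
  rw [lintegral_truncKernel_rpow 1 hα hm] at hfin
  have hs : Tendsto ((volume.restrict (Ioo (0 : ℝ) 1)) ∘ fun δ : ℝ => Ioo 0 δ) (𝓝[>] 0) (𝓝 0) := by
    have h1 : Tendsto (fun δ : ℝ => ENNReal.ofReal δ) (𝓝[>] 0) (𝓝 0) := by
      have := (ENNReal.continuous_ofReal.tendsto 0).mono_left (nhdsWithin_le_nhds (s := Ioi 0))
      simpa using this
    refine tendsto_of_tendsto_of_tendsto_of_le_of_le tendsto_const_nhds h1 (fun _ => zero_le) ?_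
    intro δ
    refine (Measure.restrict_apply_le _ _).trans ?_
    simp
  refine (tendsto_setLIntegral_zero hfin hs).congr' ?_
  filter_upwards [Ioo_mem_nhdsGT (zero_lt_one' ℝ)] with δ hδ
  rw [lintegral_truncKernel_rpow δ hα hm, Measure.restrict_restrict measurableSet_Ioo,
    inter_eq_left.2 (Ioo_subset_Ioo_right hδ.2.le)]

/-! ### Potentials of nonnegative functions -/

/-- The potential `J_α F` of a `[0, ∞]`-valued function, as a lower integral. The kernel vanishes
for nonpositive times, so that the integral may extend over the whole of space-time. -/
noncomputable def heatPot (n : ℕ) (α : ℝ) (F : SpaceTime n → ℝ≥0∞) (z : SpaceTime n) : ℝ≥0∞ :=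
  ∫⁻ w, ENNReal.ofReal (heatKernel n α (z.1 - w.1) (z.2 - w.2)) * F w

/-- The part of space-time before the time `T`. -/
def before (n : ℕ) (T : ℝ) : Set (SpaceTime n) := {z | z.2 < T}

theorem measurableSet_before (n : ℕ) (T : ℝ) : MeasurableSet (before n T) :=
  measurableSet_lt measurable_snd measurable_const

/-- For a function that vanishes before `t₀`, the values of the potential before `t₀ + δ` involve
only the kernel cut off at time `δ`. -/
theorem heatPot_eq_truncKernel {n : ℕ} {α t₀ δ S : ℝ} {F : SpaceTime n → ℝ≥0∞}
    (hF0 : ∀ᵐ w, w.2 < t₀ → F w = 0) (hS : S ≤ t₀ + δ) {z : SpaceTime n} (hz : z ∈ before n S) :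
    heatPot n α F z = ∫⁻ w, truncKernel n α δ (z - w) * (before n S).indicator F w := by
  refine lintegral_congr_ae ?_
  filter_upwards [hF0] with w hw
  have hz' : z.2 < S := hz
  by_cases h0 : w.2 < t₀
  · simp [hw h0, indicator]
  by_cases h1 : z.2 ≤ w.2
  · simp [truncKernel, heatKernel, not_lt.2 h1]
  · push Not at h0 h1
    rw [indicator_of_mem (show w ∈ before n S from h1.trans hz')]
    simp only [truncKernel, Prod.snd_sub, Prod.fst_sub]
    rw [if_pos (by linarith)]

theorem heatPot_eq_zero {n : ℕ} {α t₀ : ℝ} {F : SpaceTime n → ℝ≥0∞}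
    (hF0 : ∀ᵐ w, w.2 < t₀ → F w = 0) {z : SpaceTime n} (hz : z.2 < t₀) :
    heatPot n α F z = 0 := by
  rw [heatPot_eq_truncKernel (δ := 0) hF0 (by simp) (show z ∈ before n t₀ from hz)]
  have : ∀ w : SpaceTime n, truncKernel n α 0 (z - w) = 0 := by
    intro w
    simp only [truncKernel, heatKernel]
    split_ifs with h1 h2
    · exact absurd h1 (not_lt.2 h2.le)
    · exact ENNReal.ofReal_zero
    · rfl
  simp [this]

/-- The potential maps `L^p` to `L^r` on time slabs of length `δ`, with a constant that vanishes as
`δ → 0`, provided that `1 / p - 2 α / (n + 2) < 1 / r ≤ 1 / p`. -/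
theorem exists_heatPot_bound (n : ℕ) {α p r : ℝ} (hα : 0 < α) (hp : 1 ≤ p) (hpr : p ≤ r)
    (h : 1 / p - 2 * α / ((n : ℝ) + 2) < 1 / r) :
    ∃ C : ℝ → ℝ≥0∞, (∀ δ, C δ ≠ ⊤) ∧ Tendsto C (𝓝[>] 0) (𝓝 0) ∧
      ∀ (t₀ δ S : ℝ) (F : SpaceTime n → ℝ≥0∞), Measurable F → (∀ᵐ w, w.2 < t₀ → F w = 0) →
        S ≤ t₀ + δ → ∫⁻ z in before n S, heatPot n α F z ^ r ≤
          C δ * (∫⁻ z in before n S, F z ^ p) ^ (r / p) := by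
  have p0 : 0 < p := by linarith
  have r0 : 0 < r := by linarith
  have hrp : 1 / r ≤ 1 / p := one_div_le_one_div_of_le p0 hpr
  have hp1 : 1 / p ≤ 1 := by rw [div_le_one p0]; exact hp
  have hr0 : 0 < 1 / r := by positivity
  -- The integrability exponent `m` of the kernel in Young's inequality.
  obtain ⟨m, hm⟩ : ∃ m : ℝ, 1 / m = 1 + 1 / r - 1 / p := ⟨(1 + 1 / r - 1 / p)⁻¹, by simp⟩
  have hmpos : 0 < 1 / m := by linarith
  have m0 : 0 < m := one_div_pos.1 hmpos
  have m1 : 1 ≤ m := by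
    have : 1 / m ≤ 1 := by linarith
    rwa [div_le_one m0] at this
  have hmα : 1 - 2 * α / ((n : ℝ) + 2) < 1 / m := by linarith
  have hrm : 0 < r / m := by positivity
  refine ⟨fun δ => (∫⁻ z : SpaceTime n, truncKernel n α δ z ^ m) ^ (r / m), fun δ => ?_, ?_, ?_⟩
  · exact ENNReal.rpow_ne_top_of_nonneg hrm.le (lintegral_truncKernel_rpow_ne_top δ hα m1 hmα)
  · have := (ENNReal.continuous_rpow_const (y := r / m)).tendsto 0 |>.comp
      (tendsto_lintegral_truncKernel_rpow (n := n) hα m1 hmα)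
    rwa [ENNReal.zero_rpow_of_pos hrm] at this
  · intro t₀ δ S F hF hF0 hS
    have hB := measurableSet_before n S
    have hind : ∫⁻ z in before n S, F z ^ p = ∫⁻ z, (before n S).indicator F z ^ p := by
      rw [← lintegral_indicator hB]
      refine lintegral_congr fun z => ?_
      by_cases hz : z ∈ before n S <;> simp [hz, p0]
    have : (volume : Measure (SpaceTime n)).IsAddHaarMeasure :=
      Measure.prod.instIsAddHaarMeasure volume volume
    rw [hind]
    calc ∫⁻ z in before n S, heatPot n α F z ^ r
        = ∫⁻ z in before n S,
          (∫⁻ w, truncKernel n α δ (z - w) * (before n S).indicator F w) ^ r :=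
          setLIntegral_congr_fun hB fun z hz => by
            simp only [heatPot_eq_truncKernel hF0 hS hz]
      _ ≤ ∫⁻ z, (∫⁻ w, truncKernel n α δ (z - w) * (before n S).indicator F w) ^ r :=
          setLIntegral_le_lintegral _ _
      _ ≤ _ := lintegral_conv_rpow_le (measurable_truncKernel n α δ) (hF.indicator hB) m1 hp
          (hp.trans hpr) (by linarith)

/-! ### Uniqueness for the system of integral inequalities -/

theorem eq_zero_of_le_mul_rpow {ε M I : ℝ≥0∞} {κ : ℝ} (hκ : 1 ≤ κ) (hIM : I ≤ M) (hM : M ≠ ⊤)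
    (hε : ε * M ^ (κ - 1) < 1) (h : I ≤ ε * I ^ κ) : I = 0 := by
  by_contra hI
  have hIt : I ≠ ⊤ := ne_top_of_le_ne_top hM hIM
  have : I < I := calc
    I ≤ ε * I ^ κ := h
    _ = ε * I ^ (κ - 1) * I := by
      conv_lhs => rw [show κ = (κ - 1) + 1 by ring,
        ENNReal.rpow_add_of_nonneg _ _ (by linarith) zero_le_one, ENNReal.rpow_one]
      ring
    _ ≤ ε * M ^ (κ - 1) * I := by gcongr
    _ < 1 * I := by gcongr
    _ = I := one_mul I
  exact lt_irrefl _ this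

/-- Uniqueness by time stepping, when both potentials gain enough integrability for the estimate of
`∫ F ^ P` to close up. The exponent `r` is the one in which the potential of `F` is measured. -/
theorem eq_zero_before {n : ℕ} {α β lam sig P r T : ℝ} (hα : 0 < α) (hβ : 0 < β) (hlam : 0 < lam)
    (hsig : 0 < sig) (hκ : 1 ≤ lam * sig) (hP : 1 ≤ P) (hPr : P ≤ r) (hr : sig ≤ r)
    (hr₁ : 1 / P - 2 * α / ((n : ℝ) + 2) < 1 / r) (hr₂ : r / sig ≤ lam * P)
    (hr₃ : sig / r - 2 * β / ((n : ℝ) + 2) < 1 / (lam * P))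
    {F G : SpaceTime n → ℝ≥0∞} (hF : Measurable F) (hG : Measurable G)
    (hFG : ∀ᵐ z, F z ≤ heatPot n β G z ^ lam) (hGF : ∀ᵐ z, G z ≤ heatPot n α F z ^ sig)
    (hF0 : ∀ᵐ z, z.2 < 0 → F z = 0) (hfin : ∫⁻ z in before n T, F z ^ P ≠ ⊤) :
    ∀ᵐ z, z.2 < T → F z = 0 := by
  have P0 : 0 < P := by linarith
  have r0 : 0 < r := by linarith
  obtain ⟨Ca, -, hCa, hCa'⟩ := exists_heatPot_bound n hα hP hPr hr₁
  obtain ⟨Cb, -, hCb, hCb'⟩ := exists_heatPot_bound n (p := r / sig) (r := lam * P) hβ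
    (by rwa [le_div_iff₀ hsig, one_mul]) hr₂ (by rwa [one_div_div])
  set M := ∫⁻ z in before n T, F z ^ P with hMdef
  set c := lam * P / (r / sig) with hc
  have c0 : 0 < c := by positivity
  -- The step length is chosen such that the estimate on one step is a contraction.
  obtain ⟨δ, hδ, hδ'⟩ : ∃ δ : ℝ, 0 < δ ∧ Cb δ * Ca δ ^ c * M ^ (lam * sig - 1) < 1 := by
    have h1 : Tendsto (fun δ => Ca δ ^ c) (𝓝[>] 0) (𝓝 0) := by
      have := (ENNReal.continuous_rpow_const (y := c)).tendsto 0 |>.comp hCa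
      rwa [ENNReal.zero_rpow_of_pos c0] at this
    have hMt : M ^ (lam * sig - 1) ≠ ⊤ := ENNReal.rpow_ne_top_of_nonneg (by linarith) hfin
    have h2 := ENNReal.Tendsto.mul_const (b := M ^ (lam * sig - 1))
      (ENNReal.Tendsto.mul hCb (Or.inr ENNReal.zero_ne_top) h1 (Or.inr ENNReal.zero_ne_top))
      (Or.inr hMt)
    rw [mul_zero, zero_mul] at h2
    obtain ⟨δ, h3, h4⟩ := ((h2.eventually_lt_const zero_lt_one).and self_mem_nhdsWithin).exists
    exact ⟨δ, h4, h3⟩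
  have step : ∀ t₀ S : ℝ, S ≤ t₀ + δ → S ≤ T → (∀ᵐ z : SpaceTime n, z.2 < t₀ → F z = 0) →
      ∀ᵐ z : SpaceTime n, z.2 < S → F z = 0 := by
    intro t₀ S hS hST h0
    have hG0 : ∀ᵐ z : SpaceTime n, z.2 < t₀ → G z = 0 := by
      filter_upwards [hGF] with z hz hzt
      rwa [heatPot_eq_zero h0 hzt, ENNReal.zero_rpow_of_pos hsig, nonpos_iff_eq_zero] at hz
    have hI : ∫⁻ z in before n S, F z ^ P = 0 := by
      refine eq_zero_of_le_mul_rpow hκ (lintegral_mono_set fun z hz => ?_) hfin hδ' ?_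
      · exact lt_of_lt_of_le hz hST
      calc ∫⁻ z in before n S, F z ^ P
          ≤ ∫⁻ z in before n S, heatPot n β G z ^ (lam * P) := by
            refine lintegral_mono_ae (ae_restrict_of_ae ?_)
            filter_upwards [hFG] with z hz
            rw [ENNReal.rpow_mul]
            exact ENNReal.rpow_le_rpow hz P0.le
        _ ≤ Cb δ * (∫⁻ z in before n S, G z ^ (r / sig)) ^ c := hCb' t₀ δ S G hG hG0 hS
        _ ≤ Cb δ * (∫⁻ z in before n S, heatPot n α F z ^ r) ^ c := by
            gcongr Cb δ * ?_ ^ c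
            refine lintegral_mono_ae (ae_restrict_of_ae ?_)
            filter_upwards [hGF] with z hz
            calc G z ^ (r / sig) ≤ (heatPot n α F z ^ sig) ^ (r / sig) :=
                  ENNReal.rpow_le_rpow hz (by positivity)
              _ = _ := by rw [← ENNReal.rpow_mul, mul_div_cancel₀ _ hsig.ne']
        _ ≤ Cb δ * (Ca δ * (∫⁻ z in before n S, F z ^ P) ^ (r / P)) ^ c := by
            gcongr Cb δ * ?_ ^ c
            exact hCa' t₀ δ S F hF h0 hS
        _ = _ := by
            rw [ENNReal.mul_rpow_of_nonneg _ _ c0.le, ← ENNReal.rpow_mul, ← mul_assoc]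
            congr 2
            rw [hc]
            field_simp
    rw [lintegral_eq_zero_iff (hF.pow_const P),
      Filter.EventuallyEq, ae_restrict_iff' (measurableSet_before n S)] at hI
    filter_upwards [hI] with z hz hzS
    exact (ENNReal.rpow_eq_zero_iff_of_pos P0).1 (hz hzS)
  have iter : ∀ k : ℕ, ∀ᵐ z : SpaceTime n, z.2 < min (k * δ) T → F z = 0 := by
    intro k
    induction k with
    | zero =>
      filter_upwards [hF0] with z hz h
      exact hz (by simpa using (lt_min_iff.1 h).1)
    | succ k ih =>
      refine step _ _ ?_ (min_le_right _ _) ih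
      rw [← min_add_add_right]
      push_cast
      exact min_le_min (by linarith) (by linarith)
  obtain ⟨k, hk⟩ := exists_nat_gt (T / δ)
  rw [div_lt_iff₀ hδ] at hk
  have := iter k
  rwa [min_eq_right hk.le] at this

/-! ### Choice of exponents -/

/-- An admissible exponent `r`: the reciprocal is chosen as small as the gain of the first
potential allows, but at least `1 / (λ σ P)`. -/
theorem exists_exponent {a b lam sig P : ℝ} (ha : 0 < a) (hb : 0 < b) (hlam : 0 < lam)
    (hsig : 0 < sig) (hκ : 1 ≤ lam * sig) (P0 : 0 < P) (hlP : 1 ≤ lam * P)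
    (h₁ : sig * (1 / P - a) < 1) (h₂ : sig * (1 / P - a) < 1 / (lam * P) + b) :
    ∃ r : ℝ, P ≤ r ∧ sig ≤ r ∧ 1 / P - a < 1 / r ∧ r / sig ≤ lam * P ∧
      sig / r - b < 1 / (lam * P) := by
  suffices H : ∃ x : ℝ, 0 < x ∧ x ≤ 1 / P ∧ x ≤ 1 / sig ∧ 1 / P - a < x ∧
      1 / (lam * sig * P) ≤ x ∧ x < (1 / (lam * P) + b) / sig by
    obtain ⟨x, x0, hxP, hxs, hxa, hxl, hxb⟩ := H
    refine ⟨1 / x, (le_one_div P0 x0).2 hxP, (le_one_div hsig x0).2 hxs, by rwa [one_div_one_div],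
      ?_, ?_⟩
    · rw [div_le_iff₀ (by positivity)] at hxl
      rw [div_le_iff₀ hsig, div_le_iff₀ x0]
      linarith
    · rw [lt_div_iff₀ hsig] at hxb
      rw [div_div_eq_mul_div, div_one]
      linarith
  have l0 : 0 < 1 / (lam * sig * P) := by positivity
  have lP : 1 / (lam * sig * P) ≤ 1 / P := one_div_le_one_div_of_le P0 (by nlinarith)
  have ls : 1 / (lam * sig * P) ≤ 1 / sig := one_div_le_one_div_of_le hsig (by nlinarith)
  have lb : 1 / (lam * sig * P) < (1 / (lam * P) + b) / sig := by
    have : 1 / (lam * sig * P) = 1 / (lam * P) / sig := by field_simp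
    rw [this]
    gcongr
    linarith
  have as : 1 / P - a < 1 / sig := by rw [lt_div_iff₀ hsig]; linarith
  have ab : 1 / P - a < (1 / (lam * P) + b) / sig := by rw [lt_div_iff₀ hsig]; linarith
  rcases lt_or_ge (1 / P - a) (1 / (lam * sig * P)) with h | h
  · exact ⟨_, l0, lP, ls, h, le_rfl, lb⟩
  · obtain ⟨x, hx1, hx2⟩ := exists_between
      (lt_min (lt_min (by linarith : 1 / P - a < 1 / P) as) ab)
    rw [lt_min_iff, lt_min_iff] at hx2
    exact ⟨x, by linarith, hx2.1.1.le, hx2.1.2.le, hx1, by linarith, hx2.2⟩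

/-- The role of the normalization: together with `σ < μ(λ)`, it puts the `σ`-th power of the
potential of an `L^p` function into `L^s` for some `s > 1`. -/
theorem sig_mul_lt_one {N p q lam sig α β : ℝ} (hN : 0 < N) (hp : 1 ≤ p) (hq : 1 ≤ q)
    (hlam : 0 < lam) (hsig : 0 < sig)
    (hnorm : (N - 2 * p * α) * q ^ 2 * sig ≤ (N - 2 * q * β) * p ^ 2 * lam)
    (hsub : 0 < N - 2 * p * α) (hA : lam * sig * (N - 2 * p * α) < 2 * p * β * lam + N) :
    sig * (1 / p - 2 * α / N) < 1 := by
  have p0 : 0 < p := by linarith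
  have q0 : 0 < q := by linarith
  have h : sig * (N - 2 * p * α) * q < N * p := by
    by_contra! hcon
    have h1 : N * q * p ≤ (N - 2 * q * β) * p * lam * p := by nlinarith
    have h2 : N * q ≤ (N - 2 * q * β) * p * lam := le_of_mul_le_mul_right h1 p0
    nlinarith
  have h' : sig * (N - 2 * p * α) < N * p := by
    have : 0 < sig * (N - 2 * p * α) := by positivity
    nlinarith
  have e : sig * (1 / p - 2 * α / N) = sig * (N - 2 * p * α) / (N * p) := by field_simp
  rw [e, div_lt_one (by positivity)]
  exact h'

/-- Uniqueness for the integral inequalities with `F ∈ L^p` on every slab. For `λ p < 1` the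
integrability of `F` is first improved to `L^(1/λ)`. -/
theorem eq_zero_of_integral_inequalities {n : ℕ} {p α β lam sig : ℝ} (hp : 1 ≤ p) (hα : 0 < α)
    (hβ : 0 < β) (hlam : 0 < lam) (hsig : 0 < sig) (hκ : 1 ≤ lam * sig)
    (h₁ : sig * (1 / p - 2 * α / ((n : ℝ) + 2)) < 1)
    (hA : lam * sig * ((n : ℝ) + 2 - 2 * p * α) < 2 * p * β * lam + ((n : ℝ) + 2))
    {F G : SpaceTime n → ℝ≥0∞} (hF : Measurable F) (hG : Measurable G)
    (hFG : ∀ᵐ z, F z ≤ heatPot n β G z ^ lam) (hGF : ∀ᵐ z, G z ≤ heatPot n α F z ^ sig)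
    (hF0 : ∀ᵐ z, z.2 < 0 → F z = 0) (hfin : ∀ T, ∫⁻ z in before n T, F z ^ p ≠ ⊤) :
    ∀ᵐ z, F z = 0 := by
  have N0 : (0 : ℝ) < (n : ℝ) + 2 := by positivity
  have p0 : 0 < p := by linarith
  have hsl : 1 / lam ≤ sig := by rw [div_le_iff₀ hlam]; linarith
  obtain ⟨P, hpP, hlP, hfinP⟩ : ∃ P, p ≤ P ∧ 1 ≤ lam * P ∧
      ∀ T, ∫⁻ z in before n T, F z ^ P ≠ ⊤ := by
    rcases le_or_gt 1 (lam * p) with h | h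
    · exact ⟨p, le_rfl, h, hfin⟩
    have hpl : p < 1 / lam := by rw [lt_div_iff₀ hlam]; linarith
    refine ⟨1 / lam, hpl.le, by rw [mul_one_div_cancel hlam.ne'], fun T => ?_⟩
    obtain ⟨Ca, hCa, -, hCa'⟩ := exists_heatPot_bound n (r := sig) hα hp (by linarith)
      (by rw [lt_div_iff₀ hsig]; linarith)
    obtain ⟨Cb, hCb, -, hCb'⟩ := exists_heatPot_bound n (p := 1) (r := 1) hβ le_rfl le_rfl
      (by have : 0 < 2 * β / ((n : ℝ) + 2) := by positivity
          linarith)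
    have hG0 : ∀ᵐ z : SpaceTime n, z.2 < 0 → G z = 0 := by
      filter_upwards [hGF] with z hz hzt
      rwa [heatPot_eq_zero hF0 hzt, ENNReal.zero_rpow_of_pos hsig, nonpos_iff_eq_zero] at hz
    refine ne_top_of_le_ne_top (b := Cb T * (Ca T * (∫⁻ z in before n T, F z ^ p) ^ (sig / p)))
      (ENNReal.mul_ne_top (hCb T) (ENNReal.mul_ne_top (hCa T)
        (ENNReal.rpow_ne_top_of_nonneg (by positivity) (hfin T)))) ?_
    calc ∫⁻ z in before n T, F z ^ (1 / lam)
        ≤ ∫⁻ z in before n T, heatPot n β G z ^ (1 : ℝ) := by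
          refine lintegral_mono_ae (ae_restrict_of_ae ?_)
          filter_upwards [hFG] with z hz
          calc F z ^ (1 / lam) ≤ (heatPot n β G z ^ lam) ^ (1 / lam) :=
                ENNReal.rpow_le_rpow hz (by positivity)
            _ = _ := by rw [← ENNReal.rpow_mul, mul_one_div_cancel hlam.ne']
      _ ≤ Cb T * (∫⁻ z in before n T, G z ^ (1 : ℝ)) ^ (1 / 1 : ℝ) :=
          hCb' 0 T T G hG hG0 (by simp)
      _ ≤ Cb T * ∫⁻ z in before n T, heatPot n α F z ^ sig := by
          rw [div_one, ENNReal.rpow_one]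
          gcongr Cb T * ?_
          refine lintegral_mono_ae (ae_restrict_of_ae ?_)
          filter_upwards [hGF] with z hz
          rwa [ENNReal.rpow_one]
      _ ≤ _ := by
          gcongr Cb T * ?_
          exact hCa' 0 T T F hF hF0 (by simp)
  have P0 : 0 < P := by linarith
  have hPp : 1 / P ≤ 1 / p := one_div_le_one_div_of_le p0 hpP
  have hP₁ : sig * (1 / P - 2 * α / ((n : ℝ) + 2)) < 1 := by
    refine lt_of_le_of_lt ?_ h₁
    gcongr
  have hP₂ : sig * (1 / P - 2 * α / ((n : ℝ) + 2)) < 1 / (lam * P) + 2 * β / ((n : ℝ) + 2) := by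
    have e1 : 1 / (lam * P) = 1 / lam * (1 / P) := by field_simp
    have h3 : (sig - 1 / lam) * (1 / P) ≤ (sig - 1 / lam) * (1 / p) :=
      mul_le_mul_of_nonneg_left hPp (by linarith)
    have h4 : (sig - 1 / lam) * (1 / p) <
        sig * (2 * α / ((n : ℝ) + 2)) + 2 * β / ((n : ℝ) + 2) := by
      have e2 : (sig - 1 / lam) * (1 / p) = (lam * sig - 1) / (lam * p) := by field_simp
      have e3 : sig * (2 * α / ((n : ℝ) + 2)) + 2 * β / ((n : ℝ) + 2) =
          (sig * (2 * α) + 2 * β) / ((n : ℝ) + 2) := by field_simp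
      rw [e2, e3, div_lt_div_iff₀ (by positivity) N0]
      linarith
    rw [e1]
    linarith
  obtain ⟨r, hr1, hr2, hr3, hr4, hr5⟩ := exists_exponent (a := 2 * α / ((n : ℝ) + 2))
    (b := 2 * β / ((n : ℝ) + 2)) (by positivity) (by positivity) hlam hsig hκ P0 hlP hP₁ hP₂
  have hall : ∀ k : ℕ, ∀ᵐ z : SpaceTime n, z.2 < k → F z = 0 := fun k =>
    eq_zero_before hα hβ hlam hsig hκ (hp.trans hpP) hr1 hr2 hr3 hr4 hr5 hF hG hFG hGF hF0
      (hfinP k)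
  filter_upwards [ae_all_iff.2 hall] with z hz
  obtain ⟨k, hk⟩ := exists_nat_gt z.2
  exact hz k hk

/-! ### From the integral operators to lower integrals -/

/-- No integrability is needed: where the Bochner integral takes its default value `0`, the
inequality is trivial. -/
theorem ofReal_J_le {n : ℕ} {α : ℝ} (hα : 0 < α) {f : SpaceTime n → ℝ} (hf : ∀ᵐ w, 0 ≤ f w)
    (z : SpaceTime n) :
    ENNReal.ofReal (J n α f z) ≤ heatPot n α (fun w => ENNReal.ofReal (f w)) z := by
  unfold J
  by_cases hint : IntegrableOn (fun w : SpaceTime n =>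
      heatKernel n α (z.1 - w.1) (z.2 - w.2) * f w) (univ ×ˢ Iio z.2)
  · rw [ofReal_integral_eq_lintegral_ofReal hint (ae_restrict_of_ae ?_)]
    · refine (setLIntegral_le_lintegral _ _).trans (le_of_eq ?_)
      exact lintegral_congr fun w => ENNReal.ofReal_mul (heatKernel_nonneg n hα _ _)
    · filter_upwards [hf] with w hw
      exact mul_nonneg (heatKernel_nonneg n hα _ _) hw
  · rw [integral_undef hint, ENNReal.ofReal_zero]
    exact zero_le

theorem J_nonneg {n : ℕ} {α : ℝ} (hα : 0 < α) {f : SpaceTime n → ℝ} (hf : ∀ᵐ w, 0 ≤ f w)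
    (z : SpaceTime n) : 0 ≤ J n α f z := by
  refine integral_nonneg_of_ae (ae_restrict_of_ae ?_)
  filter_upwards [hf] with w hw
  exact mul_nonneg (heatKernel_nonneg n hα _ _) hw

theorem J_eq_zero {n : ℕ} {α : ℝ} {f : SpaceTime n → ℝ} (hf : ∀ᵐ w, f w = 0)
    (z : SpaceTime n) : J n α f z = 0 := by
  refine integral_eq_zero_of_ae (ae_restrict_of_ae ?_)
  filter_upwards [hf] with w hw
  simp [hw]

theorem aemeasurable_of_mem_X {n : ℕ} {p : ℝ} {f : SpaceTime n → ℝ} (hf : f ∈ X n p) :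
    AEMeasurable f := by
  have hU : (⋃ k : ℕ, (univ ×ˢ Iio (k : ℝ) : Set (SpaceTime n))) = univ := by
    refine eq_univ_of_forall fun z => mem_iUnion.2 ?_
    obtain ⟨k, hk⟩ := exists_nat_gt z.2
    exact ⟨k, mem_univ _, hk⟩
  rw [← Measure.restrict_univ (μ := volume), ← hU, aemeasurable_iUnion_iff]
  exact fun k => (hf k).aestronglyMeasurable.aemeasurable

theorem lintegral_ofReal_rpow_ne_top {n : ℕ} {p : ℝ} (hp : 1 ≤ p) {f : SpaceTime n → ℝ}
    (hf : f ∈ X n p) (T : ℝ) : ∫⁻ z in before n T, ENNReal.ofReal (f z) ^ p ≠ ⊤ := by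
  have p0 : 0 < p := by linarith
  have hset : (univ ×ˢ Iio T : Set (SpaceTime n)) = before n T := by
    ext z
    simp [before]
  have h := (hf T).eLpNorm_lt_top
  rw [eLpNorm_lt_top_iff_lintegral_rpow_enorm_lt_top (by simpa using p0) ENNReal.ofReal_ne_top,
    ENNReal.toReal_ofReal p0.le, hset] at h
  refine ne_top_of_le_ne_top h.ne (lintegral_mono fun z => ?_)
  exact ENNReal.rpow_le_rpow (Real.ofReal_le_enorm _) p0.le

/-- A pointwise inequality `f ≤ v ^ λ` with `v = J_β g` passes to the potential of any function that
represents the positive part of `g`. -/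
theorem ofReal_le_heatPot_rpow {n : ℕ} {β lam : ℝ} (hβ : 0 < β) (hlam : 0 < lam)
    {f g v : SpaceTime n → ℝ} {F G : SpaceTime n → ℝ≥0∞} (hg : ∀ᵐ w, 0 ≤ g w)
    (hF : ∀ᵐ z, F z = ENNReal.ofReal (f z)) (hG : ∀ᵐ z, G z = ENNReal.ofReal (g z))
    (hv : J n β g =ᵐ[volume] v) (hfv : ∀ᵐ z, f z ≤ v z ^ lam) :
    ∀ᵐ z, F z ≤ heatPot n β G z ^ lam := by
  filter_upwards [hF, hv, hfv] with z h1 h2 h3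
  have hpot : heatPot n β G z = heatPot n β (fun w => ENNReal.ofReal (g w)) z := by
    refine lintegral_congr_ae ?_
    filter_upwards [hG] with w hw
    rw [hw]
  rw [h1, hpot]
  have hv0 : 0 ≤ v z := h2 ▸ J_nonneg hβ hg z
  calc ENNReal.ofReal (f z) ≤ ENNReal.ofReal (v z ^ lam) := ENNReal.ofReal_le_ofReal h3
    _ = ENNReal.ofReal (J n β g z) ^ lam := by rw [h2, ENNReal.ofReal_rpow_of_nonneg hv0 hlam.le]
    _ ≤ _ := ENNReal.rpow_le_rpow (ofReal_J_le hβ hg z) hlam.le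

end FracHeat

theorem theorem2p1 (n : ℕ) (hn : 1 ≤ n) (p q lam sig α β : ℝ)
    (hp : 1 ≤ p) (hq : 1 ≤ q) (hlam : 0 < lam) (hsig : 0 < sig) (hα : 0 < α) (hβ : 0 < β)
    (hpα : FracHeat.Admissible n p α) (hqβ : FracHeat.Admissible n q β)
    (hnorm : ((n : ℝ) + 2 - 2 * p * α) * q ^ 2 * sig ≤ ((n : ℝ) + 2 - 2 * q * β) * p ^ 2 * lam)
    (hsub : 2 * p * α < (n : ℝ) + 2)
    (hA₁ : 1 / lam ≤ sig) (hA₂ : sig < FracHeat.mu n p α β lam)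
    (u v : FracHeat.SpaceTime n → ℝ)
    (hu : u ∈ FracHeat.Y n p α) (hv : v ∈ FracHeat.Y n q β)
    (hineq_u : ∀ᵐ z : FracHeat.SpaceTime n,
      0 ≤ FracHeat.fracHeat n p α u z ∧ FracHeat.fracHeat n p α u z ≤ v z ^ lam)
    (hineq_v : ∀ᵐ z : FracHeat.SpaceTime n,
      0 ≤ FracHeat.fracHeat n q β v z ∧ FracHeat.fracHeat n q β v z ≤ u z ^ sig)
    (hinit : ∀ᵐ z : FracHeat.SpaceTime n, z.2 < 0 → u z = 0 ∧ v z = 0) :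
    (∀ᵐ z : FracHeat.SpaceTime n, u z = 0) ∧ (∀ᵐ z : FracHeat.SpaceTime n, v z = 0) := by
  have hfX := FracHeat.fracHeat_mem hu
  have hfJ := FracHeat.J_fracHeat hu
  have hgX := FracHeat.fracHeat_mem hv
  have hgJ := FracHeat.J_fracHeat hv
  generalize FracHeat.fracHeat n p α u = f at *
  generalize FracHeat.fracHeat n q β v = g at *
  have hf0 : ∀ᵐ z, 0 ≤ f z := hineq_u.mono fun _ h => h.1
  have hg0 : ∀ᵐ z, 0 ≤ g z := hineq_v.mono fun _ h => h.1
  have N0 : (0 : ℝ) < (n : ℝ) + 2 := by positivity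
  have A0 : (0 : ℝ) < (n : ℝ) + 2 - 2 * p * α := by linarith
  have hκ : 1 ≤ lam * sig := by
    rw [div_le_iff₀ hlam] at hA₁
    linarith
  have hA : lam * sig * ((n : ℝ) + 2 - 2 * p * α) < 2 * p * β * lam + ((n : ℝ) + 2) := by
    have e : FracHeat.mu n p α β lam =
        (2 * p * β * lam + ((n : ℝ) + 2)) / (((n : ℝ) + 2 - 2 * p * α) * lam) := by
      rw [FracHeat.mu]
      field_simp
    rw [e, lt_div_iff₀ (by positivity)] at hA₂
    linarith
  have h₁ := FracHeat.sig_mul_lt_one N0 hp hq hlam hsig hnorm A0 hA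
  have hFm := (FracHeat.aemeasurable_of_mem_X hfX).ennreal_ofReal
  have hGm := (FracHeat.aemeasurable_of_mem_X hgX).ennreal_ofReal
  have hF : ∀ᵐ z, hFm.mk _ z = ENNReal.ofReal (f z) := hFm.ae_eq_mk.mono fun _ h => h.symm
  have hG : ∀ᵐ z, hGm.mk _ z = ENNReal.ofReal (g z) := hGm.ae_eq_mk.mono fun _ h => h.symm
  have hFzero := FracHeat.eq_zero_of_integral_inequalities hp hα hβ hlam hsig hκ h₁ hA
    hFm.measurable_mk hGm.measurable_mk
    (FracHeat.ofReal_le_heatPot_rpow hβ hlam hg0 hF hG hgJ (hineq_u.mono fun _ h => h.2))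
    (FracHeat.ofReal_le_heatPot_rpow hα hsig hf0 hG hF hfJ (hineq_v.mono fun _ h => h.2))
    (by
      filter_upwards [hF, hineq_u, hinit] with z h2 h3 h4 hz
      have h5 := h3.2
      rw [(h4 hz).2, Real.zero_rpow hlam.ne'] at h5
      rw [h2, ENNReal.ofReal_of_nonpos h5])
    (fun T => by
      rw [lintegral_congr_ae (ae_restrict_of_ae (hF.mono fun z hz => congrArg (· ^ p) hz))]
      exact FracHeat.lintegral_ofReal_rpow_ne_top hp hfX T)
  have hf : ∀ᵐ z, f z = 0 := by
    filter_upwards [hFzero, hF, hf0] with z h2 h3 h4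
    rw [h2] at h3
    exact le_antisymm (ENNReal.ofReal_eq_zero.1 h3.symm) h4
  have huz : ∀ᵐ z, u z = 0 := by
    filter_upwards [hfJ] with z hz
    rw [← hz, FracHeat.J_eq_zero hf]
  have hg : ∀ᵐ z, g z = 0 := by
    filter_upwards [huz, hineq_v] with z h2 h3
    have h5 := h3.2
    rw [h2, Real.zero_rpow hsig.ne'] at h5
    exact le_antisymm h5 h3.1
  refine ⟨huz, ?_⟩
  filter_upwards [hgJ] with z hz
  rw [← hz, FracHeat.J_eq_zero hg]
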